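/- All graphs are finite, simple and undirected; they may carry a vertex coloring $\lambda_V : V(G)\to\mathcal C$ and an edge coloring $\lambda_E : E(G)\to\mathcal D$ (uncolored graphs are the case of one vertex color and one edge color). For $d\in\mathcal D$ let $N_d(x)$ be the set of neighbors of $x$ through edges of color $d$. *WL test (color refinement).* Put $\chi_G^0=\lambda_V$ and $\chi_G^{\ell+1}(x)=\bigl(\chi_G^{\ell}(x),\,(\{\!\{\chi_G^{\ell}(y): y\in N_d(x)\}\!\})_{d\in\mathcal D}\bigr)$. Graphs $G$ and $H$ (with colors from the same sets) are refined in parallel up to the first round $\ell$ in which the partition of $V(G)\sqcup V(H)$ into color classes is the same as in round $\ell+1$. They are *indistinguishable by WL* if for every color $c$ the sets $\{x\in V(G):\chi_G^\ell(x)=c\}$ and $\{y\in V(H):\chi_H^\ell(y)=c\}$ have the same cardinality. *$k$-WL test.* For $\overline v\in V(G)^k$ let $\chi_G^0(\overline v)$ be the atomic type of $\overline v$ (which entries are equal, which are adjacent, and the colors of the entries and of the edges between them), and let $\chi_G^{\ell+1}(\overline v)=\bigl(\chi_G^\ell(\overline v),\chi^\ell_{G,1}(\overline v),\dots,\chi^\ell_{G,k}(\overline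 v)\bigr)$ with $\chi_{G,i}^\ell(\overline v)=\{\!\{\chi_G^\ell(v_1,\dots,v_{i-1},x,v_{i+1},\dots,v_k): x\in V(G)\}\!\}$. Again $G$ and $H$ are refined in parallel up to the first round $\ell$ in which the partition of $V(G)^k\sqcup V(H)^k$ is the same as in round $\ell+1$, and they are *indistinguishable by $k$-WL* if for every color $c$ the sets $\{\overline v\in V(G)^k:\chi_G^\ell(\overline v)=c\}$ and $\{\overline w\in V(H)^k:\chi_H^\ell(\overline w)=c\}$ have the same cardinality. For $\overline u\in V(G)^t$ let $G^{\overline u}$ be the graph $G$ in which every vertex $x$ additionally carries as label the set $\{i : u_i=x\}$ of its positions in $\overline u$. **Lemma.** Let $k\ge 3$ and let $G$ and $H$ be indistinguishable by $k$-WL. Then for every $t\le k-2$ and every $\overline u\in V(G)^t$ there exists $\overline v\in V(H)^t$ such that $G^{\overline u}$ and $H^{\overline v}$ are indistinguishable by WL. -/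

import Mathlib

universe u v w

/-- An undirected simple graph on the vertex set `V`, with a vertex coloring by colors from `C`
and an edge coloring by colors from `D`. An uncolored graph is the case where `C` and `D` have one
element. -/
structure ColoredGraph (V : Type v) (C D : Type u) where
  graph : SimpleGraph V
  vertexColor : V → C
  edgeColor : graph.edgeSet → D

namespace ColoredGraph

variable {V : Type v} {C D : Type u}

/-- `x` and `y` are joined by an edge of color `d`; so `N_d(x) = {y | G.AdjOfColor d x y}`. -/
def AdjOfColor (G : ColoredGraph V C D) (d : D) (x y : V) : Prop :=
  ∃ h : G.graph.Adj x y, G.edgeColor ⟨s(x, y), h⟩ = d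

/-- The graph in which every vertex additionally carries the set of its positions in the tuple
`p` (the empty set, if the vertex does not occur in `p`). -/
def pebbled {t : ℕ} (G : ColoredGraph V C D) (p : Fin t → V) :
    ColoredGraph V (C × Set (Fin t)) D where
  graph := G.graph
  vertexColor x := (G.vertexColor x, {i | p i = x})
  edgeColor := G.edgeColor

end ColoredGraph

/-- `ℓ` is the first round in which the partition of `X` into color classes of `χ ℓ` equals the
partition into color classes of `χ (ℓ + 1)`. -/
def IsStableRound {X : Type v} {K : ℕ → Type u} (χ : (ℓ : ℕ) → X → K ℓ) (ℓ : ℕ) : Prop :=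
  IsLeast {n : ℕ | ∀ x y : X, χ n x = χ n y ↔ χ (n + 1) x = χ (n + 1) y} ℓ

/-- Two refinement processes (with common colors) on `X` and on `Y` are run in parallel until the
partition of the disjoint union of `X` and `Y` is stable; then every color is required to occur
equally often in `X` and in `Y`. -/
def SameStableColors {X : Type v} {Y : Type w} {K : ℕ → Type u}
    (χ : (ℓ : ℕ) → X → K ℓ) (ψ : (ℓ : ℕ) → Y → K ℓ) : Prop :=
  ∃ ℓ : ℕ, IsStableRound (fun n => Sum.elim (χ n) (ψ n)) ℓ ∧
    ∀ c : K ℓ, {x : X | χ ℓ x = c}.ncard = {y : Y | ψ ℓ y = c}.ncard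

section OneDimensional

/-- The colors that may occur after a number of rounds of color refinement. -/
def WLColor (C D : Type u) : ℕ → Type u
  | 0 => C
  | n + 1 => WLColor C D n × (D → Multiset (WLColor C D n))

variable {V : Type v} {W : Type w} [Fintype V] [Fintype W] {C D : Type u}

open Classical in
/-- Color refinement: the new color of `x` consists of its old color and, for each edge color `d`,
the multiset of the old colors of the neighbors of `x` through edges of color `d`. -/
noncomputable def wlColor (G : ColoredGraph V C D) : (ℓ : ℕ) → V → WLColor C D ℓ
  | 0, x => G.vertexColor x
  | n + 1, x => (wlColor G n x, fun d =>
      (Finset.univ.filter fun y : V => G.AdjOfColor d x y).val.map (wlColor G n))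

/-- `G` and `H` are not distinguished by the Weisfeiler-Leman test. The neighbors of a vertex in
the disjoint union of `G` and `H` are its neighbors in the graph it comes from, so the coloring of
the disjoint union is given by `wlColor G` and `wlColor H`. -/
def WLIndistinguishable (G : ColoredGraph V C D) (H : ColoredGraph W C D) : Prop :=
  SameStableColors (wlColor G) (wlColor H)

end OneDimensional

section HigherDimensional

/-- Atomic types of `k`-tuples: which entries are equal, the colors of the entries, and for each
edge color, which entries are joined by an edge of that color. -/
def AtomicType (k : ℕ) (C D : Type u) : Type u :=
  (Fin k → Fin k → Prop) × (Fin k → C) × (Fin k → Fin k → D → Prop)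

/-- The colors that may occur after a number of rounds of the `k`-dimensional algorithm. -/
def KWLColor (k : ℕ) (C D : Type u) : ℕ → Type u
  | 0 => AtomicType k C D
  | n + 1 => KWLColor k C D n × (Fin k → Multiset (KWLColor k C D n))

variable {V : Type v} {W : Type w} {C D : Type u}

def atomicType {k : ℕ} (G : ColoredGraph V C D) (p : Fin k → V) : AtomicType k C D :=
  (fun i j => p i = p j, fun i => G.vertexColor (p i), fun i j d => G.AdjOfColor d (p i) (p j))

variable [Fintype V] [Fintype W]

/-- The `k`-dimensional algorithm: the new color of the tuple `p` consists of its old color and,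
for each position `i`, the multiset of the old colors of the tuples that arise from `p` by
replacing its `i`-th entry by a vertex `x`, where `x` runs through all vertices. -/
noncomputable def kwlColor (k : ℕ) (G : ColoredGraph V C D) :
    (ℓ : ℕ) → (Fin k → V) → KWLColor k C D ℓ
  | 0, p => atomicType G p
  | n + 1, p => (kwlColor k G n p, fun i =>
      (Finset.univ : Finset V).val.map fun x => kwlColor k G n (Function.update p i x))

/-- `G` and `H` are not distinguished by the `k`-dimensional Weisfeiler-Leman test. -/
def KWLIndistinguishable (k : ℕ) (G : ColoredGraph V C D) (H : ColoredGraph W C D) : Prop :=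
  SameStableColors (kwlColor k G) (kwlColor k H)

end HigherDimensional

/-! In the stable round, a color shared by a `k`-tuple of `G` and one of `H` provides, in each
position, a bijection between the vertex sets that preserves colors under replacement
(`IsStableRound.isBijectiveBisimulation`). Pad the given `t`-tuple to a `k`-tuple `P` and take a
tuple `Q` of `H` with the color of `P`; its pebbled entries are the required tuple. At least two
positions are free: one holds the vertex being refined, the other runs through its neighbors, so the
`k`-tuples simulate every round of color refinement on the pebbled graphs
(`IsBijectiveBisimulation.wlColor_pebbled_eq`). -/

open Classical in
theorem exists_equiv_of_map_univ_eq {α : Type*} {β : Type*} {γ : Type*} [Fintype α] [Fintype β]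
    {f : α → γ} {g : β → γ}
    (h : (Finset.univ : Finset α).val.map f = (Finset.univ : Finset β).val.map g) :
    ∃ σ : α ≃ β, ∀ a, g (σ a) = f a := by
  have hcard (c : γ) : Fintype.card {a // f a = c} = Fintype.card {b // g b = c} := by
    have hc := congrArg (Multiset.count c) h
    rw [Multiset.count_map, Multiset.count_map] at hc
    rw [Fintype.card_subtype, Fintype.card_subtype]
    simpa only [Finset.card_def, Finset.filter_val, eq_comm] using hc
  exact ⟨Equiv.ofFiberEquiv fun c => Fintype.equivOfCardEq (hcard c),
    fun a => Equiv.ofFiberEquiv_map _ a⟩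

/-- The sets of pairs already told apart increase with the round, and an increasing chain of subsets
of the finite set `X × X` becomes constant. -/
theorem exists_isStableRound {X : Type v} [Finite X] {K : ℕ → Type u} (χ : (ℓ : ℕ) → X → K ℓ)
    (hχ : ∀ n x y, χ (n + 1) x = χ (n + 1) y → χ n x = χ n y) : ∃ ℓ, IsStableRound χ ℓ := by
  let s : ℕ →o Set (X × X) := ⟨fun n => {z | χ n z.1 ≠ χ n z.2},
    monotone_nat_of_le_succ fun n z hz hz' => hz (hχ n _ _ hz')⟩
  obtain ⟨n, hn⟩ := WellFoundedGT.monotone_chain_condition s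
  have hne : {n : ℕ | ∀ x y : X, χ n x = χ n y ↔ χ (n + 1) x = χ (n + 1) y}.Nonempty := by
    refine ⟨n, fun x y => ?_⟩
    have := Set.ext_iff.1 (hn (n + 1) n.le_succ) (x, y)
    exact not_iff_not.1 this
  exact ⟨_, Nat.sInf_mem hne, fun _ hm => Nat.sInf_le hm⟩

/-- A relation between `k`-tuples of vertices with the invariants of the stable colors of the
`k`-dimensional algorithm: related tuples have the same atomic type, and in each position the
vertices can be replaced along a bijection. -/
structure IsBijectiveBisimulation {V : Type v} {W : Type w} {C D : Type u} {k : ℕ}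
    (G : ColoredGraph V C D) (H : ColoredGraph W C D) (E : (Fin k → V) → (Fin k → W) → Prop) :
    Prop where
  atomicType_eq : ∀ {p q}, E p q → atomicType G p = atomicType H q
  exists_equiv : ∀ {p q}, E p q → ∀ i, ∃ σ : V ≃ W, ∀ x,
    E (Function.update p i x) (Function.update q i (σ x))

section

variable {V : Type v} {W : Type w} [Fintype V] [Fintype W] {C D : Type u}

theorem atomicType_eq_of_kwlColor_eq {k : ℕ} {G : ColoredGraph V C D} {H : ColoredGraph W C D}
    {n : ℕ} {p : Fin k → V} {q : Fin k → W} (h : kwlColor k G n p = kwlColor k H n q) :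
    atomicType G p = atomicType H q := by
  induction n with
  | zero => exact h
  | succ n ih => exact ih (congrArg Prod.fst h)

theorem IsStableRound.isBijectiveBisimulation {k : ℕ} {G : ColoredGraph V C D}
    {H : ColoredGraph W C D} {ℓ : ℕ}
    (hℓ : IsStableRound (fun n => Sum.elim (kwlColor k G n) (kwlColor k H n)) ℓ) :
    IsBijectiveBisimulation G H fun p q => kwlColor k G ℓ p = kwlColor k H ℓ q where
  atomicType_eq := atomicType_eq_of_kwlColor_eq
  exists_equiv {p q} h i := by
    -- Stability on the disjoint union also applies to a pair with one tuple from each graph; the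
    -- colors of round `ℓ + 1` contain the multisets of replacements.
    have h' : kwlColor k G (ℓ + 1) p = kwlColor k H (ℓ + 1) q :=
      (hℓ.1 (Sum.inl p) (Sum.inr q)).1 h
    obtain ⟨σ, hσ⟩ := exists_equiv_of_map_univ_eq (congrFun (congrArg Prod.snd h') i)
    exact ⟨σ, fun x => (hσ x).symm⟩

/-- One bijection serves all rounds, so it does not matter which round is the stable one. -/
theorem wlIndistinguishable_of_equiv {G : ColoredGraph V C D} {H : ColoredGraph W C D}
    (σ : V ≃ W) (hσ : ∀ n x, wlColor G n x = wlColor H n (σ x)) : WLIndistinguishable G H := by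
  obtain ⟨ℓ, hℓ⟩ := exists_isStableRound (fun n => Sum.elim (wlColor G n) (wlColor H n)) <| by
    rintro n (x | x) (y | y) h <;> exact congrArg Prod.fst h
  refine ⟨ℓ, hℓ, fun c => ?_⟩
  rw [← Set.ncard_image_of_injective _ σ.injective]
  congr 1
  ext y
  simp only [Set.mem_image, Set.mem_ofPred_eq, hσ]
  exact ⟨by rintro ⟨x, hx, rfl⟩; exact hx, fun hy => ⟨σ.symm y, by simpa using hy, by simp⟩⟩

open Classical in
/-- Vertices in related tuples have the same colors after pebbling any positions, as long as at
least two positions carry no pebble. -/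
theorem IsBijectiveBisimulation.wlColor_pebbled_eq {k t : ℕ} {G : ColoredGraph V C D}
    {H : ColoredGraph W C D} {E : (Fin k → V) → (Fin k → W) → Prop}
    (hE : IsBijectiveBisimulation G H E) (e : Fin t → Fin k)
    (he : ∀ j, ∃ j', j' ≠ j ∧ j' ∉ Set.range e) {p : Fin t → V} {q : Fin t → W} (n : ℕ)
    {P : Fin k → V} {Q : Fin k → W} (hPQ : E P Q) (hP : ∀ i, P (e i) = p i)
    (hQ : ∀ i, Q (e i) = q i) (j : Fin k) :
    wlColor (G.pebbled p) n (P j) = wlColor (H.pebbled q) n (Q j) := by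
  induction n generalizing P Q j with
  | zero =>
    have h := hE.atomicType_eq hPQ
    refine Prod.ext (congrFun (congrArg (fun a => a.2.1) h) j) (Set.ext fun i => ?_)
    have h' : (P (e i) = P j) = (Q (e i) = Q j) :=
      congrFun (congrFun (congrArg Prod.fst h) (e i)) j
    rw [hP, hQ] at h'
    exact h'.to_iff
  | succ n ih =>
    refine Prod.ext (ih hPQ hP hQ j) (funext fun d => ?_)
    -- Replacing entry `j'` moves neither a pebble nor the vertex in position `j`, so the induction
    -- hypothesis applies to the new tuples, and their atomic types record adjacency to that vertex.
    obtain ⟨j', hj, hj'⟩ := he j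
    obtain ⟨σ, hσ⟩ := hE.exists_equiv hPQ j'
    have hne (i : Fin t) : e i ≠ j' := fun h => hj' ⟨i, h⟩
    have hcolor (x : V) : wlColor (G.pebbled p) n x = wlColor (H.pebbled q) n (σ x) := by
      simpa using ih (hσ x) (fun i => by simp [hne, hP]) (fun i => by simp [hne, hQ]) j'
    have hadj (x : V) : (G.pebbled p).AdjOfColor d (P j) x ↔
        (H.pebbled q).AdjOfColor d (Q j) (σ x) := by
      have h := congrFun (congrFun (congrFun
        (congrArg (fun a => a.2.2) (hE.atomicType_eq (hσ x))) j) j') d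
      have h' : G.AdjOfColor d (P j) x ↔ H.AdjOfColor d (Q j) (σ x) := by
        simpa [atomicType, hj.symm] using h.to_iff
      exact h'
    have hmap : (Finset.univ.filter fun y => (H.pebbled q).AdjOfColor d (Q j) y) =
        (Finset.univ.filter fun x => (G.pebbled p).AdjOfColor d (P j) x).map σ.toEmbedding := by
      ext y
      simp [Finset.mem_map_equiv, hadj]
    have hfilter : ((Finset.univ.filter fun x => (G.pebbled p).AdjOfColor d (P j) x).val.map
        (wlColor (G.pebbled p) n)) =
        ((Finset.univ.filter fun y => (H.pebbled q).AdjOfColor d (Q j) y).val.map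
        (wlColor (H.pebbled q) n)) := by
      rw [hmap, Finset.map_val, Multiset.map_map]
      exact Multiset.map_congr rfl fun x _ => hcolor x
    exact hfilter

end

theorem mainTheorem10 {V : Type v} {W : Type w} [Fintype V] [Fintype W] {C D : Type u}
    (G : ColoredGraph V C D) (H : ColoredGraph W C D) (k : ℕ) (hk : 3 ≤ k)
    (hGH : KWLIndistinguishable k G H) (t : ℕ) (ht : t ≤ k - 2) (p : Fin t → V) :
    ∃ q : Fin t → W, WLIndistinguishable (G.pebbled p) (H.pebbled q) := by
  obtain ⟨ℓ, hℓ, hcard⟩ := hGH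
  have hE := hℓ.isBijectiveBisimulation
  let e : Fin t → Fin k := Fin.castLE (by omega)
  have hlt (i : Fin t) : (e i : ℕ) < t := i.2
  -- Positions `t` and `t + 1` are free, and `j` is at most one of them; this is where `t ≤ k - 2`
  -- is needed.
  have he (j : Fin k) : ∃ j', j' ≠ j ∧ j' ∉ Set.range e := by
    by_cases hj : (j : ℕ) = t
    · refine ⟨⟨t + 1, by omega⟩, fun h => ?_, ?_⟩
      · have := congrArg Fin.val h
        simp at this
        omega
      · rintro ⟨i, hi⟩
        have := hlt i
        simp [hi] at this
    · refine ⟨⟨t, by omega⟩, fun h => hj (congrArg Fin.val h).symm, ?_⟩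
      rintro ⟨i, hi⟩
      have := hlt i
      simp [hi] at this
  -- If `V` is empty, no vertex is available for padding. Then `W` is empty too, since the color of
  -- a constant tuple of `H` would have to occur in `G`.
  rcases isEmpty_or_nonempty V with hV | hV
  · have ht0 : t = 0 := by
      by_contra h
      exact hV.elim (p ⟨0, by omega⟩)
    have hW : IsEmpty W := by
      refine ⟨fun y => ?_⟩
      have h := hcard (kwlColor k H ℓ fun _ => y)
      have : IsEmpty (Fin k → V) := ⟨fun P => hV.elim (P ⟨0, by omega⟩)⟩
      rw [Set.eq_empty_of_isEmpty {P | kwlColor k G ℓ P = _}, Set.ncard_empty] at h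
      have hmem : (fun _ => y) ∈ {Q | kwlColor k H ℓ Q = kwlColor k H ℓ fun _ => y} := rfl
      exact ((Set.ncard_pos (Set.toFinite _)).2 ⟨_, hmem⟩).ne h
    subst ht0
    exact ⟨Fin.elim0, wlIndistinguishable_of_equiv (Equiv.equivOfIsEmpty V W)
      fun _ x => hV.elim x⟩
  · obtain ⟨x₀⟩ := hV
    let P : Fin k → V := fun j => if h : (j : ℕ) < t then p ⟨j, h⟩ else x₀
    have hP (i : Fin t) : P (e i) = p i := by simp [P, e]
    have hpos : 0 < {Q | kwlColor k H ℓ Q = kwlColor k G ℓ P}.ncard := by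
      rw [← hcard]
      exact (Set.ncard_pos (Set.toFinite _)).2 ⟨P, rfl⟩
    obtain ⟨Q, hQ⟩ := (Set.ncard_pos (Set.toFinite _)).1 hpos
    -- Any free position will do: as its entry runs through `V`, the bijection there matches all
    -- vertices of the two graphs.
    obtain ⟨j, -, hj⟩ := he ⟨0, by omega⟩
    have hne (i : Fin t) : e i ≠ j := fun h => hj ⟨i, h⟩
    obtain ⟨σ, hσ⟩ := hE.exists_equiv (p := P) (q := Q) hQ.symm j
    refine ⟨fun i => Q (e i), wlIndistinguishable_of_equiv σ fun n x => ?_⟩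
    simpa using hE.wlColor_pebbled_eq e he n (hσ x) (fun i => by simp [hne, hP])
      (fun i => by simp [hne]) j
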